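/- Conventions. All graphs are simple, and a connected graph $X$ is identified with its vertex set, equipped with the path metric. For a subset $A$ of a finite graph $X$, let $\partial A$ be the set of vertices of $X\setminus A$ adjacent to some vertex of $A$. For $c>0$, the graph $X$ is a *$c$-expander* if there is no non-empty $A\subseteq X$ with $|A|\le \frac12|X|$ and $|\partial A|\le c|A|$. A sequence of finite graphs with uniformly bounded degree and $|X_n|\to\infty$ is a *sequence of expanders* if there is a $c>0$ such that every $X_n$ is a $c$-expander. If $|X|\ge 2$, the *Cheeger constant* of $X$ is $$h(X)=\min\Big\{\tfrac{|\partial A|}{|A|} : A\subseteq X,\ 0<|A|\le \tfrac12|X|\Big\},$$ and $A$ *realises* $h(X)$ if $0<|A|\le\frac12|X|$ and $|\partial A|=h(X)|A|$. A graph with at most one vertex has no such subsets. A *coarse disjoint union* of finite connected graphs $\{X_n\}_{n\in\mathbb N}$ is the set $X=\bigsqcup_n X_n$ with a metric $d$ which restricts to the path metric on each $X_n$ and satisfies $d(X_n,X_m)\ge n+m+\operatorname{diam}(X_n)+\operatorname{diam}(X_m)$ for $n\ne m$. The *averaging projection* $P_X\in B(\ell^2(X))$ is $P_X=\bigoplus_n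 P_{X_n}$, where $P_{X_n}$ is the orthogonal projection onto the span of the characteristic function $\chi_{X_n}$. An operator $T=[T_{x,y}]\in B(\ell^2(X))$ has *finite propagation* if there is an $R$ such that $d(x,y)\le R$ whenever $T_{x,y}\neq0$; the *uniform Roe algebra* $C^*_u(X)$ is the operator-norm closure in $B(\ell^2(X))$ of the $*$-algebra of operators of finite propagation. **Statement.** Let $\{X_n\}_{n\in\mathbb N}$ be a sequence of finite connected graphs with uniformly bounded degree and $|X_n|\to\infty$, such that each $X_n$ admits more than one maximal (with respect to inclusion) subset among those realising the Cheeger constant $h(X_n)$. Let $X$ be any coarse disjoint union of $\{X_n\}$. Then the following are equivalent: 1. $\{X_n\}_{n\in\mathbb N}$ is a sequence of expanders; 2. the averaging projection $P_X$ belongs to the uniform Roe algebra $C^*_u(X)$. Moreover, every finite connected vertex-transitive graph with at least two vertices admits more than one maximal subset realising its Cheeger constant. -/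

import Mathlib

open Filter
open scoped ENNReal InnerProductSpace

noncomputable section

namespace CoarseGraph

/-! ### Graphs: boundaries, Følner sets, the Cheeger constant, expanders -/

section Graphs

variable {V : Type*} [Fintype V]

open Classical in
/-- The outer boundary `∂A`: the vertices outside `A` at path-distance at most `1` from `A`,
that is, the vertices outside `A` adjacent to some vertex of `A`. -/
def boundary (G : SimpleGraph V) (A : Finset V) : Finset V :=
  Finset.univ.filter fun x => x ∉ A ∧ ∃ a ∈ A, G.Adj a x

/-- `A` is `c`-Følner: `|A| ≤ |X| / 2` and `|∂A| ≤ c |A|`. -/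
def IsFolner (G : SimpleGraph V) (c : ℝ) (A : Finset V) : Prop :=
  (A.card : ℝ) ≤ (Fintype.card V : ℝ) / 2 ∧ ((boundary G A).card : ℝ) ≤ c * A.card

/-- A graph is a `c`-expander if it has no non-empty `c`-Følner set. -/
def IsExpander (G : SimpleGraph V) (c : ℝ) : Prop :=
  ∀ A : Finset V, A.Nonempty → ¬ IsFolner G c A

/-- The sets over which the Cheeger constant is a minimum: `0 < |A| ≤ |X| / 2`. -/
def IsCheegerCandidate (A : Finset V) : Prop :=
  0 < A.card ∧ (A.card : ℝ) ≤ (Fintype.card V : ℝ) / 2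

/-- The Cheeger constant `h(X) = min { |∂A| / |A| : 0 < |A| ≤ |X| / 2 }`
(a minimum over a finite set, which is non-empty as soon as `X` has at least two vertices). -/
def cheegerConst (G : SimpleGraph V) : ℝ :=
  sInf ((fun A : Finset V => ((boundary G A).card : ℝ) / A.card) '' {A | IsCheegerCandidate A})

/-- `A` realises the Cheeger constant of `G`. -/
def RealisesCheeger (G : SimpleGraph V) (A : Finset V) : Prop :=
  IsCheegerCandidate A ∧ ((boundary G A).card : ℝ) / A.card = cheegerConst G

/-- `G` admits more than one subset that is maximal, with respect to inclusion, among the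
subsets realising the Cheeger constant. -/
def HasManyMaximalCheegerSets (G : SimpleGraph V) : Prop :=
  ∃ A B : Finset V, A ≠ B ∧ Maximal (RealisesCheeger G) A ∧ Maximal (RealisesCheeger G) B

/-- Every vertex can be mapped to every other one by a graph automorphism. -/
def IsVertexTransitive (G : SimpleGraph V) : Prop :=
  ∀ x y : V, ∃ φ : G ≃g G, φ x = y

end Graphs

section Sequences

variable {V : ℕ → Type*} [∀ n, Fintype (V n)]

/-- The degrees of all the graphs of the sequence are bounded by one constant. -/
def UniformlyBoundedDegree (G : ∀ n, SimpleGraph (V n)) : Prop :=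
  ∃ D : ℕ, ∀ (n : ℕ) (v : V n), ((G n).neighborSet v).ncard ≤ D

/-- A sequence of expander graphs: uniformly bounded degrees, cardinalities going to infinity,
and one `c > 0` such that every graph of the sequence is a `c`-expander. -/
def IsExpanderSequence (G : ∀ n, SimpleGraph (V n)) : Prop :=
  UniformlyBoundedDegree G ∧ Tendsto (fun n => Fintype.card (V n)) atTop atTop ∧
    ∃ c : ℝ, 0 < c ∧ ∀ n, IsExpander (G n) c

/-- The metric on the disjoint union `X` of the `X_n` makes it a coarse disjoint union of the
connected finite graphs `X_n`: it restricts to the path metric on each `X_n`, and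
`d(X_n, X_m) ≥ n + m + diam X_n + diam X_m` whenever `n ≠ m`. -/
structure IsCoarseDisjointUnion (G : ∀ n, SimpleGraph (V n)) [MetricSpace (Σ n, V n)] :
    Prop where
  dist_same : ∀ (n : ℕ) (x y : V n),
    dist (⟨n, x⟩ : Σ n, V n) ⟨n, y⟩ = ((G n).dist x y : ℝ)
  le_dist : ∀ (n m : ℕ), n ≠ m → ∀ (x : V n) (y : V m),
    (n : ℝ) + m + (G n).diam + (G m).diam ≤ dist (⟨n, x⟩ : Σ n, V n) ⟨m, y⟩

end Sequences

/-! ### Operators on `ℓ²(X)` and the uniform Roe algebra -/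

/-- The Hilbert space `ℓ²(X)` of square-summable complex functions on `X`. -/
abbrev L2 (X : Type*) : Type _ := lp (fun _ : X => ℂ) 2

section Operators

variable {X : Type*}

open Classical in
/-- The basis vector `δ_x` of `ℓ²(X)`. -/
def delta (x : X) : L2 X := lp.single 2 x (1 : ℂ)

/-- The matrix coefficient `T_{x,y}`: the value at `x` of `T δ_y`. -/
def coeff (T : L2 X →L[ℂ] L2 X) (x y : X) : ℂ := T (delta y) x

/-- `T` has finite propagation: its support lies in `{(x, y) : d(x, y) ≤ R}` for some `R`. -/
def HasFinitePropagation [MetricSpace X] (T : L2 X →L[ℂ] L2 X) : Prop :=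
  ∃ R : ℝ, ∀ x y : X, coeff T x y ≠ 0 → dist x y ≤ R

theorem inner_delta (x : X) (f : L2 X) : ⟪delta x, f⟫_ℂ = f x := by
  classical
  unfold delta
  rw [lp.inner_single_left]
  simp

theorem delta_apply_ne {x y : X} (h : x ≠ y) : (delta y : L2 X) x = 0 := by
  classical
  unfold delta
  exact lp.single_apply_ne 2 y 1 h

theorem hasSum_delta (f : L2 X) : HasSum (fun x => f x • delta x) f := by
  classical
  have h := lp.hasSum_single (p := 2) (by norm_num) f
  convert h using 2 with x
  unfold delta
  rw [← lp.single_smul]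
  simp only [smul_eq_mul, mul_one]

theorem coeff_mul (S T : L2 X →L[ℂ] L2 X) (x z : X) :
    HasSum (fun y => coeff S x y * coeff T y z) (coeff (S * T) x z) := by
  have h := ((hasSum_delta (T (delta z))).mapL S).mapL (innerSL ℂ (delta x))
  simpa [coeff, inner_delta, mul_comm] using h

theorem coeff_star (T : L2 X →L[ℂ] L2 X) (x y : X) :
    coeff (star T) x y = star (coeff T y x) := by
  unfold coeff
  rw [← inner_delta x, ← inner_delta y, ContinuousLinearMap.star_eq_adjoint,
    ContinuousLinearMap.adjoint_inner_right, ← inner_conj_symm]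
  rfl

theorem coeff_algebraMap (a : ℂ) {x y : X} (h : x ≠ y) :
    coeff (algebraMap ℂ (L2 X →L[ℂ] L2 X) a) x y = 0 := by
  simp [coeff, Algebra.algebraMap_eq_smul_one, delta_apply_ne h]

/-- The algebraic uniform Roe algebra `ℂ_u[X]`: all bounded operators on `ℓ²(X)` of finite
propagation. -/
def algebraicUniformRoeAlgebra (X : Type*) [MetricSpace X] :
    StarSubalgebra ℂ (L2 X →L[ℂ] L2 X) where
  carrier := {T | HasFinitePropagation T}
  mul_mem' := by
    rintro S T ⟨R, hR⟩ ⟨Q, hQ⟩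
    refine ⟨R + Q, fun x z h => ?_⟩
    by_contra hlt
    refine h ((coeff_mul S T x z).unique ?_)
    convert hasSum_zero using 2 with y
    by_contra hne
    have h1 := hR x y (left_ne_zero_of_mul hne)
    have h2 := hQ y z (right_ne_zero_of_mul hne)
    exact hlt ((dist_triangle x y z).trans (add_le_add h1 h2))
  add_mem' := by
    rintro S T ⟨R, hR⟩ ⟨Q, hQ⟩
    refine ⟨max R Q, fun x y h => ?_⟩
    by_cases hS : coeff S x y = 0
    · refine (hQ x y fun hT => h ?_).trans (le_max_right _ _)
      have : coeff (S + T) x y = coeff S x y + coeff T x y := by simp [coeff]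
      rw [this, hS, hT, add_zero]
    · exact (hR x y hS).trans (le_max_left _ _)
  algebraMap_mem' a := by
    refine ⟨0, fun x y h => ?_⟩
    by_contra hlt
    refine h (coeff_algebraMap a ?_)
    rintro rfl
    simp at hlt
  star_mem' := by
    rintro T ⟨R, hR⟩
    refine ⟨R, fun x y h => ?_⟩
    rw [coeff_star, star_ne_zero] at h
    rw [dist_comm]
    exact hR y x h

/-- The uniform Roe algebra `C*_u(X)`: the operator-norm closure of `ℂ_u[X]` in `B(ℓ²(X))`. -/
def uniformRoeAlgebra (X : Type*) [MetricSpace X] : StarSubalgebra ℂ (L2 X →L[ℂ] L2 X) :=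
  (algebraicUniformRoeAlgebra X).topologicalClosure

/-! ### Averaging projections -/

/-- The characteristic function `χ_F` of a finite set, as a vector of `ℓ²(X)`. -/
def chi (F : Finset X) : L2 X := ∑ x ∈ F, delta x

/-- The averaging projection `P_F` of a finite set `F`: the orthogonal projection of `ℓ²(X)`
onto the span of `χ_F`. -/
def finsetAveragingProjection (F : Finset X) : L2 X →L[ℂ] L2 X :=
  (Submodule.span ℂ {chi F}).starProjection

end Operators

section Averaging

variable (V : ℕ → Type*) [∀ n, Fintype (V n)]

/-- The `n`-th piece `X_n` as a finite subset of the disjoint union `X`. -/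
def piece (n : ℕ) : Finset (Σ n, V n) :=
  (Finset.univ : Finset (V n)).map (Function.Embedding.sigmaMk n)

/-- The averaging projection `P_X = ⨁ P_{X_n}`. The lines spanned by the `χ_{X_n}` are mutually
orthogonal, so this direct sum is the orthogonal projection onto their closed linear span;
`hasSum_averagingProjection` below confirms that `P_X f = ∑ P_{X_n} f` for all `f`. -/
def averagingProjection : L2 (Σ n, V n) →L[ℂ] L2 (Σ n, V n) :=
  (⨆ n, Submodule.span ℂ {chi (piece V n)}).topologicalClosure.starProjection

theorem inner_chi_piece {n m : ℕ} (h : n ≠ m) :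
    ⟪chi (piece V n), chi (piece V m)⟫_ℂ = 0 := by
  unfold chi
  rw [sum_inner]
  refine Finset.sum_eq_zero fun x hx => ?_
  rw [inner_sum]
  refine Finset.sum_eq_zero fun y hy => ?_
  rw [inner_delta]
  apply delta_apply_ne
  rintro rfl
  simp only [piece, Finset.mem_map, Finset.mem_univ, true_and] at hx hy
  obtain ⟨a, rfl⟩ := hx
  obtain ⟨b, hb⟩ := hy
  exact h (congrArg Sigma.fst hb).symm

/-- `P_X` is the direct sum of the `P_{X_n}`. -/
theorem hasSum_averagingProjection (f : L2 (Σ n, V n)) :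
    HasSum (fun n => finsetAveragingProjection (piece V n) f) (averagingProjection V f) := by
  have hfam : OrthogonalFamily ℂ (fun n => Submodule.span ℂ {chi (piece V n)})
      fun n => (Submodule.span ℂ {chi (piece V n)}).subtypeₗᵢ := by
    rintro n m h ⟨v, hv⟩ ⟨w, hw⟩
    obtain ⟨a, rfl⟩ := Submodule.mem_span_singleton.1 hv
    obtain ⟨b, rfl⟩ := Submodule.mem_span_singleton.1 hw
    simp [inner_smul_left, inner_smul_right, inner_chi_piece V h]
  set K : ℕ → Submodule ℂ (L2 (Σ n, V n)) := fun n => Submodule.span ℂ {chi (piece V n)} with hK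
  let U : Finset ℕ → Submodule ℂ (L2 (Σ n, V n)) := fun s => s.sup K
  have hfd : ∀ s, FiniteDimensional ℂ (U s) := fun s => by
    dsimp only [U]
    infer_instance
  have hmono : Monotone U := fun s t h => Finset.sup_mono h
  have hsup : ⨆ s, U s = ⨆ n, K n := by
    rw [iSup_eq_iSup_finset K]
    simp only [U, Finset.sup_eq_iSup]
  have ht := Submodule.starProjection_tendsto_closure_iSup U hmono f
  unfold averagingProjection
  rw [HasSum, SummationFilter.unconditional_filter]
  simp only [hsup] at ht
  convert ht using 2 with s
  symm
  apply Submodule.eq_starProjection_of_mem_of_inner_eq_zero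
  · exact Submodule.sum_mem _ fun n hn =>
      (Finset.le_sup hn : K n ≤ U s) (Submodule.starProjection_apply_mem _ _)
  · set w := f - ∑ n ∈ s, finsetAveragingProjection (piece V n) f with hw
    have hle : U s ≤ (Submodule.span ℂ {w})ᗮ := by
      refine Finset.sup_le fun n hn v hv => ?_
      rw [Submodule.mem_orthogonal_singleton_iff_inner_right, hw,
        ← Finset.add_sum_erase s _ hn, ← sub_sub, inner_sub_left, sum_inner]
      have h1 : ⟪f - finsetAveragingProjection (piece V n) f, v⟫_ℂ = 0 :=
        Submodule.starProjection_inner_eq_zero _ _ hv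
      rw [h1, zero_sub, neg_eq_zero]
      refine Finset.sum_eq_zero fun m hm => ?_
      exact hfam (Finset.ne_of_mem_erase hm)
        ⟨finsetAveragingProjection (piece V m) f, Submodule.starProjection_apply_mem _ _⟩ ⟨v, hv⟩
    intro v hv
    exact (Submodule.mem_orthogonal_singleton_iff_inner_right).1 (hle hv)

end Averaging

end CoarseGraph

end

/-! Expanders give `P_X`: let `T` be the direct sum of the operators `1 - Δ / (2D)` of the pieces.
It has propagation at most one, fixes functions constant on pieces and preserves sums over pieces,
so `T P = P T = P`. Cheeger's inequality bounds `‖T - P‖` by a constant below one, uniformly over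
the pieces, hence `T ^ k - P = (T - P) ^ k → 0` and `P` is a norm limit of powers of `T`. The
spectral gap comes from a co-area argument (`mul_sum_le_variation`), applied to the squares of the
two parts of a function around its median.

Conversely, `P_X` in the Roe algebra only excludes poorly expanding sets that fill a fixed
proportion of a piece. The assumption on maximal Cheeger sets supplies those. The function `A ↦
|∂A|` is submodular, so a union of Cheeger sets of size at most half is again a Cheeger set; two
distinct maximal ones therefore have a union larger than half, and one of them exceeds a quarter
(`HasManyMaximalCheegerSets.exists_large`). If `h` is tiny, bounded degree makes the
`R`-neighbourhood of that set `A` barely larger than `A`, so its complement `B` is large too. An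
operator of propagation `R` has no entries between `A` and `B`, whereas all those of `P` are `1 /
|X_n|`; so it stays at a definite distance from `P`.

For vertex-transitive graphs, automorphisms permute the maximal Cheeger sets; a unique one would be
invariant, hence the whole graph. -/

namespace CoarseGraph

/-! ### Submodularity of the boundary and maximal Cheeger sets -/

section CheegerSets

variable {V : Type*} [Fintype V]

theorem mem_boundary {G : SimpleGraph V} {A : Finset V} {x : V} :
    x ∈ boundary G A ↔ x ∉ A ∧ ∃ a ∈ A, G.Adj a x := by
  simp [boundary]

open Classical in
/-- The closed neighbourhood `A ∪ ∂A`. -/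
noncomputable def closedNbhd (G : SimpleGraph V) (A : Finset V) : Finset V := A ∪ boundary G A

theorem mem_closedNbhd {G : SimpleGraph V} {A : Finset V} {x : V} :
    x ∈ closedNbhd G A ↔ x ∈ A ∨ ∃ a ∈ A, G.Adj a x := by
  classical
  simp only [closedNbhd, Finset.mem_union, mem_boundary]
  tauto

theorem subset_closedNbhd (G : SimpleGraph V) (A : Finset V) : A ⊆ closedNbhd G A :=
  fun _ hx => mem_closedNbhd.2 (Or.inl hx)

theorem card_closedNbhd (G : SimpleGraph V) (A : Finset V) :
    (closedNbhd G A).card = A.card + (boundary G A).card := by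
  classical
  rw [closedNbhd, Finset.card_union_of_disjoint]
  exact Finset.disjoint_left.2 fun x hx h => (mem_boundary.1 h).1 hx

open Classical in
-- Since `|A ∪ ∂A| = |A| + |∂A|`, this follows from modularity of cardinality: closed neighbourhoods
-- respect unions and send an intersection into the intersection.
theorem card_boundary_union_add_inter_le (G : SimpleGraph V) (A B : Finset V) :
    (boundary G (A ∪ B)).card + (boundary G (A ∩ B)).card ≤
      (boundary G A).card + (boundary G B).card := by
  have hunion : closedNbhd G (A ∪ B) ⊆ closedNbhd G A ∪ closedNbhd G B := by
    intro x hx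
    simp only [mem_closedNbhd, Finset.mem_union] at hx ⊢
    grind
  have hinter : closedNbhd G (A ∩ B) ⊆ closedNbhd G A ∩ closedNbhd G B := by
    intro x hx
    simp only [mem_closedNbhd, Finset.mem_inter] at hx ⊢
    grind
  have h1 := Finset.card_le_card hunion
  have h2 := Finset.card_le_card hinter
  have h3 := Finset.card_union_add_card_inter (closedNbhd G A) (closedNbhd G B)
  have h4 := Finset.card_union_add_card_inter A B
  simp only [card_closedNbhd] at *
  omega

theorem cheegerConst_le (G : SimpleGraph V) {A : Finset V} (hA : IsCheegerCandidate A) :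
    cheegerConst G ≤ ((boundary G A).card : ℝ) / A.card :=
  csInf_le (Set.toFinite _).bddBelow ⟨A, hA, rfl⟩

/-- The product form survives `A = ∅`, which matters for the possibly empty intersection of two
Cheeger sets. -/
theorem cheegerConst_mul_card_le (G : SimpleGraph V) {A : Finset V}
    (hA : (A.card : ℝ) ≤ (Fintype.card V : ℝ) / 2) :
    cheegerConst G * A.card ≤ (boundary G A).card := by
  rcases Nat.eq_zero_or_pos A.card with h | h
  · simp [h]
  · have := cheegerConst_le G (A := A) ⟨h, hA⟩
    rwa [le_div_iff₀ (by exact_mod_cast h)] at this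

theorem RealisesCheeger.card_boundary {G : SimpleGraph V} {A : Finset V}
    (hA : RealisesCheeger G A) : ((boundary G A).card : ℝ) = cheegerConst G * A.card := by
  have h : (0 : ℝ) < A.card := by exact_mod_cast hA.1.1
  rw [← hA.2, div_mul_cancel₀ _ h.ne']

/-- Two sets realising the Cheeger constant whose union is small have a union realising it. -/
theorem RealisesCheeger.union [DecidableEq V] {G : SimpleGraph V} {A B : Finset V}
    (hA : RealisesCheeger G A) (hB : RealisesCheeger G B)
    (hAB : ((A ∪ B).card : ℝ) ≤ (Fintype.card V : ℝ) / 2) : RealisesCheeger G (A ∪ B) := by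
  have hpos : 0 < (A ∪ B).card := hA.1.1.trans_le (Finset.card_le_card Finset.subset_union_left)
  refine ⟨⟨hpos, hAB⟩, le_antisymm ?_ (cheegerConst_le G ⟨hpos, hAB⟩)⟩
  rw [div_le_iff₀ (by exact_mod_cast hpos)]
  have h1 : ((boundary G (A ∪ B)).card : ℝ) + (boundary G (A ∩ B)).card ≤
      (boundary G A).card + (boundary G B).card := by
    have := card_boundary_union_add_inter_le G A B
    convert (Nat.cast_le (α := ℝ)).2 this using 1 <;> push_cast <;> congr!
  have h2 : cheegerConst G * (A ∩ B).card ≤ (boundary G (A ∩ B)).card := by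
    refine cheegerConst_mul_card_le G (le_trans ?_ hA.1.2)
    exact_mod_cast Finset.card_le_card Finset.inter_subset_left
  have h3 : ((A ∪ B).card : ℝ) + (A ∩ B).card = A.card + B.card := by
    exact_mod_cast Finset.card_union_add_card_inter A B
  rw [hA.card_boundary, hB.card_boundary] at h1
  have h4 := congrArg (cheegerConst G * ·) h3
  simp only [mul_add] at h4
  linarith

/-- If there are several maximal sets realising the Cheeger constant, then one of them contains
more than a quarter of the vertices. -/
theorem HasManyMaximalCheegerSets.exists_large {G : SimpleGraph V}
    (h : HasManyMaximalCheegerSets G) :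
    ∃ A : Finset V, RealisesCheeger G A ∧ (Fintype.card V : ℝ) / 4 < A.card := by
  classical
  obtain ⟨A, B, hne, hA, hB⟩ := h
  by_contra! hsmall
  have hle : ((A ∪ B).card : ℝ) ≤ A.card + B.card := by exact_mod_cast Finset.card_union_le A B
  have hU := hA.prop.union hB.prop (by linarith [hsmall A hA.prop, hsmall B hB.prop])
  have h1 : A = A ∪ B := hA.eq_of_le hU Finset.subset_union_left
  have h2 : B = A ∪ B := hB.eq_of_le hU Finset.subset_union_right
  exact hne (h1.trans h2.symm)

theorem exists_realisesCheeger (G : SimpleGraph V) (hV : 2 ≤ Fintype.card V) :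
    ∃ A : Finset V, RealisesCheeger G A := by
  obtain ⟨v⟩ : Nonempty V := Fintype.card_pos_iff.1 (by omega)
  have hne : {A : Finset V | IsCheegerCandidate A}.Nonempty := by
    refine ⟨{v}, by simp, ?_⟩
    have : (2 : ℝ) ≤ Fintype.card V := by exact_mod_cast hV
    simp only [Finset.card_singleton, Nat.cast_one]
    linarith
  obtain ⟨A, hA, hAe⟩ := (hne.image fun A : Finset V =>
    ((boundary G A).card : ℝ) / A.card).csInf_mem (Set.toFinite _)
  exact ⟨A, hA, hAe⟩

theorem boundary_map (G : SimpleGraph V) (φ : G ≃g G) (A : Finset V) :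
    boundary G (A.map φ.toEquiv.toEmbedding) = (boundary G A).map φ.toEquiv.toEmbedding := by
  ext x
  obtain ⟨y, rfl⟩ := φ.surjective x
  have hmem : ∀ (B : Finset V) (z : V), φ z ∈ B.map φ.toEquiv.toEmbedding ↔ z ∈ B := fun B z =>
    Finset.mem_map' φ.toEquiv.toEmbedding
  rw [hmem, mem_boundary, mem_boundary, hmem]
  simp only [Finset.mem_map, exists_exists_and_eq_and]
  exact and_congr_right fun _ => exists_congr fun a => and_congr_right fun _ => φ.map_adj_iff

theorem RealisesCheeger.map {G : SimpleGraph V} {A : Finset V} (hA : RealisesCheeger G A)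
    (φ : G ≃g G) : RealisesCheeger G (A.map φ.toEquiv.toEmbedding) := by
  obtain ⟨⟨h1, h2⟩, h3⟩ := hA
  exact ⟨⟨by rwa [Finset.card_map], by rwa [Finset.card_map]⟩,
    by rwa [boundary_map, Finset.card_map, Finset.card_map]⟩

theorem maximal_realisesCheeger_map {G : SimpleGraph V} {A : Finset V}
    (hA : Maximal (RealisesCheeger G) A) (φ : G ≃g G) :
    Maximal (RealisesCheeger G) (A.map φ.toEquiv.toEmbedding) := by
  refine ⟨hA.prop.map φ, fun B hB hle => ?_⟩
  refine (Finset.eq_of_subset_of_card_le hle ?_).ge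
  have hsub : A ⊆ B.map φ.symm.toEquiv.toEmbedding := by
    intro x hx
    exact Finset.mem_map.2 ⟨φ x, hle (Finset.mem_map.2 ⟨x, hx, rfl⟩), φ.symm_apply_apply x⟩
  have := hA.eq_of_le (hB.map φ.symm) hsub
  rw [Finset.card_map, this, Finset.card_map]

theorem IsVertexTransitive.hasManyMaximalCheegerSets {G : SimpleGraph V}
    (h : IsVertexTransitive G) (hV : 2 ≤ Fintype.card V) : HasManyMaximalCheegerSets G := by
  obtain ⟨B, hB⟩ := exists_realisesCheeger G hV
  obtain ⟨A, -, hA⟩ := Set.Finite.exists_le_maximal (Set.toFinite {A | RealisesCheeger G A}) hB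
  by_contra hone
  have hinv : ∀ φ : G ≃g G, A.map φ.toEquiv.toEmbedding = A := fun φ => by
    by_contra hne
    exact hone ⟨_, _, hne, maximal_realisesCheeger_map hA φ, hA⟩
  obtain ⟨a, ha⟩ := Finset.card_pos.1 hA.prop.1.1
  have huniv : A = Finset.univ := by
    refine Finset.eq_univ_of_forall fun x => ?_
    obtain ⟨φ, rfl⟩ := h a x
    rw [← hinv φ]
    exact Finset.mem_map.2 ⟨a, ha, rfl⟩
  have hle := hA.prop.1.2
  rw [huniv, Finset.card_univ] at hle
  have : (2 : ℝ) ≤ Fintype.card V := by exact_mod_cast hV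
  linarith

end CheegerSets

/-! ### Growth of iterated neighbourhoods -/

section Growth

variable {V : Type*} [Fintype V] {G : SimpleGraph V}

/-- A vertex of the second layer has no neighbour in `A`, so it is adjacent to a vertex of `∂A`. -/
theorem boundary_closedNbhd_card_le {D : ℕ} (hD : ∀ v, (G.neighborSet v).ncard ≤ D)
    (A : Finset V) : (boundary G (closedNbhd G A)).card ≤ D * (boundary G A).card := by
  classical
  have hsub : boundary G (closedNbhd G A) ⊆
      (boundary G A).biUnion fun b => (G.neighborSet b).toFinset := by
    intro x hx
    simp only [mem_boundary, mem_closedNbhd, Finset.mem_biUnion, Set.mem_toFinset,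
      SimpleGraph.mem_neighborSet] at hx ⊢
    grind
  refine (Finset.card_le_card hsub).trans ?_
  rw [mul_comm]
  refine Finset.card_biUnion_le_card_mul _ _ _ fun b _ => ?_
  rw [← Set.ncard_eq_toFinset_card']
  exact hD b

/-- Successive layers grow by a factor of at most `D`. A small boundary thus stays small at scale
`k`, with a constant depending only on `D` and `k`. -/
theorem iterate_closedNbhd_card_le {D : ℕ} (hD : ∀ v, (G.neighborSet v).ncard ≤ D) (k : ℕ) :
    ∀ A : Finset V, ((closedNbhd G)^[k] A).card ≤
      A.card + (∑ i ∈ Finset.range k, D ^ i) * (boundary G A).card := by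
  induction k with
  | zero => intro A; simp
  | succ k ih =>
    intro A
    rw [Function.iterate_succ_apply]
    refine (ih _).trans ?_
    rw [card_closedNbhd, Finset.sum_range_succ', add_assoc]
    gcongr
    rw [Finset.sum_congr rfl fun i _ => pow_succ D i, ← Finset.sum_mul, add_mul, mul_assoc,
      pow_zero, one_mul, add_comm]
    gcongr
    exact boundary_closedNbhd_card_le hD A

theorem subset_iterate_closedNbhd (k : ℕ) (A : Finset V) : A ⊆ (closedNbhd G)^[k] A := by
  induction k with
  | zero => exact subset_rfl
  | succ k ih =>
    rw [Function.iterate_succ_apply']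
    exact ih.trans (subset_closedNbhd G _)

theorem mem_iterate_closedNbhd_of_walk {k : ℕ} {a x : V} (w : G.Walk a x) :
    ∀ {A : Finset V}, a ∈ A → w.length ≤ k → x ∈ (closedNbhd G)^[k] A := by
  induction w generalizing k with
  | nil => intro A ha _; exact subset_iterate_closedNbhd k A ha
  | cons hadj w ih =>
    intro A ha hk
    rw [SimpleGraph.Walk.length_cons] at hk
    obtain ⟨k, rfl⟩ : ∃ j, k = j + 1 := ⟨k - 1, by omega⟩
    rw [Function.iterate_succ_apply]
    exact ih (mem_closedNbhd.2 (Or.inr ⟨_, ha, hadj⟩)) (by omega)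

theorem mem_iterate_closedNbhd_of_dist_le (hG : G.Connected) {k : ℕ} {A : Finset V} {a x : V}
    (ha : a ∈ A) (h : G.dist a x ≤ k) : x ∈ (closedNbhd G)^[k] A := by
  obtain ⟨w, hw⟩ := hG.exists_walk_length_eq_dist a x
  exact mem_iterate_closedNbhd_of_walk w ha (hw ▸ h)

end Growth

/-! ### Cheeger's inequality -/

section CheegerInequality

variable {V : Type*}

open Classical in
/-- The adjacency matrix of `G` with real entries. -/
noncomputable def adj (G : SimpleGraph V) (x y : V) : ℝ := if G.Adj x y then 1 else 0

theorem adj_nonneg (G : SimpleGraph V) (x y : V) : 0 ≤ adj G x y := by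
  unfold adj; split_ifs <;> norm_num

theorem adj_comm (G : SimpleGraph V) (x y : V) : adj G x y = adj G y x := by
  by_cases h : G.Adj x y
  · simp [adj, h, h.symm]
  · have h' : ¬ G.Adj y x := fun h' => h h'.symm
    simp [adj, h, h']

variable [Fintype V]

theorem sum_adj_le {G : SimpleGraph V} {D : ℕ} (hD : ∀ v, (G.neighborSet v).ncard ≤ D) (x : V) :
    ∑ y, adj G x y ≤ D := by
  classical
  have h : ∑ y, adj G x y = ((G.neighborSet x).ncard : ℝ) := by
    rw [Set.ncard_eq_toFinset_card']
    simp only [adj, Finset.sum_boole]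
    congr 2
    ext y
    simp
  rw [h]
  exact_mod_cast hD x

theorem sum_sum_adj_mul_le {G : SimpleGraph V} {D : ℕ} (hD : ∀ v, (G.neighborSet v).ncard ≤ D)
    {f : V → ℝ} (hf : ∀ x, 0 ≤ f x) : ∑ x, ∑ y, adj G x y * f x ≤ D * ∑ x, f x := by
  rw [Finset.mul_sum]
  gcongr with x
  rw [← Finset.sum_mul]
  exact mul_le_mul_of_nonneg_right (sum_adj_le hD x) (hf x)

theorem sum_sum_adj_comm (G : SimpleGraph V) (F : V → V → ℝ) :
    ∑ x, ∑ y, adj G x y * F x y = ∑ x, ∑ y, adj G x y * F y x := by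
  rw [Finset.sum_comm]
  simp only [adj_comm G]

/-- The Dirichlet energy (each edge being counted twice). -/
noncomputable def energy (G : SimpleGraph V) (f : V → ℝ) : ℝ :=
  ∑ x, ∑ y, adj G x y * (f x - f y) ^ 2

/-- The total variation (each edge being counted twice). -/
noncomputable def variation (G : SimpleGraph V) (f : V → ℝ) : ℝ :=
  ∑ x, ∑ y, adj G x y * |f x - f y|

theorem energy_nonneg (G : SimpleGraph V) (f : V → ℝ) : 0 ≤ energy G f :=
  Finset.sum_nonneg fun x _ => Finset.sum_nonneg fun y _ =>
    mul_nonneg (adj_nonneg G x y) (sq_nonneg _)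

open Classical in
theorem card_boundary_le_variation (G : SimpleGraph V) (A : Finset V) :
    ((boundary G A).card : ℝ) ≤ variation G fun x => if x ∈ A then 1 else 0 := by
  have hnn : ∀ x y : V, 0 ≤ adj G x y * |(if x ∈ A then (1 : ℝ) else 0) - if y ∈ A then 1 else 0| :=
    fun x y => mul_nonneg (adj_nonneg G x y) (abs_nonneg _)
  unfold variation
  calc ((boundary G A).card : ℝ) = ∑ x ∈ boundary G A, (1 : ℝ) := by simp
    _ ≤ ∑ x ∈ boundary G A,
        ∑ y, adj G x y * |(if x ∈ A then (1 : ℝ) else 0) - if y ∈ A then 1 else 0| := by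
      refine Finset.sum_le_sum fun x hx => ?_
      obtain ⟨hxA, a, ha, hadj⟩ := by simpa [boundary] using hx
      refine le_trans ?_ (Finset.single_le_sum (fun y _ => hnn x y) (Finset.mem_univ a))
      simp [adj, hxA, ha, hadj.symm]
    _ ≤ _ := Finset.sum_le_sum_of_subset_of_nonneg (Finset.subset_univ _)
        fun x _ _ => Finset.sum_nonneg fun y _ => hnn x y

open Classical in
/-- The co-area inequality: an isoperimetric inequality for the subsets of the support of `f`
gives an `L¹`-Poincaré inequality for `f`. -/
theorem mul_sum_le_variation {G : SimpleGraph V} {c : ℝ} (k : ℕ)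
    (hiso : ∀ A : Finset V, A.card ≤ k → c * A.card ≤ (boundary G A).card) (f : V → ℝ)
    (hf : ∀ x, 0 ≤ f x) (hk : (Finset.univ.filter fun x => 0 < f x).card ≤ k) :
    c * ∑ x, f x ≤ variation G f := by
  induction h : (Finset.univ.filter fun x => 0 < f x).card using Nat.strong_induction_on
    generalizing f with
  | _ j ih =>
  subst h
  set A := Finset.univ.filter fun x => 0 < f x with hA
  have hmemA : ∀ x, x ∈ A ↔ 0 < f x := by simp [hA]
  rcases A.eq_empty_or_nonempty with hempty | hne
  · have hz : ∀ x, f x = 0 := fun x => by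
      have : x ∉ A := by simp [hempty]
      rw [hmemA] at this
      exact le_antisymm (not_lt.1 this) (hf x)
    simp [variation, hz]
  obtain ⟨a, haA, hamin⟩ := A.exists_min_image f hne
  have ha : 0 < f a := (hmemA a).1 haA
  -- Peel off the lowest level of `f` on its support `A`. The support shrinks strictly, and both the
  -- sum and the variation split additively.
  let g : V → ℝ := fun x => f x - f a * if x ∈ A then 1 else 0
  have hgdef : ∀ x, g x = f x - f a * if x ∈ A then 1 else 0 := fun x => rfl
  have hoff : ∀ x, x ∉ A → f x = 0 := fun x hx =>
    le_antisymm (not_lt.1 fun h => hx ((hmemA x).2 h)) (hf x)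
  have hg : ∀ x, 0 ≤ g x := fun x => by
    rw [hgdef]
    split_ifs with hx
    · linarith [hamin x hx]
    · simpa using hf x
  have hsub : (Finset.univ.filter fun x => 0 < g x) ⊂ A := by
    refine (Finset.ssubset_iff_of_subset fun x hx => ?_).2 ⟨a, haA, by simp [hgdef, haA]⟩
    by_contra hxA
    simp [hgdef, hxA, hoff x hxA] at hx
  have hcard := Finset.card_lt_card hsub
  have h1 := ih _ hcard g hg (hcard.le.trans hk) rfl
  have h2 : c * A.card ≤ variation G fun x => if x ∈ A then 1 else 0 :=
    (hiso A hk).trans (card_boundary_le_variation G A)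
  have hvar : variation G f = variation G g +
      f a * variation G fun x => if x ∈ A then 1 else 0 := by
    unfold variation
    rw [Finset.mul_sum, ← Finset.sum_add_distrib]
    refine Finset.sum_congr rfl fun x _ => ?_
    rw [Finset.mul_sum, ← Finset.sum_add_distrib]
    refine Finset.sum_congr rfl fun y _ => ?_
    have key : |f x - f y| = |g x - g y| +
        f a * |(if x ∈ A then (1 : ℝ) else 0) - if y ∈ A then 1 else 0| := by
      by_cases hx : x ∈ A <;> by_cases hy : y ∈ A <;> simp only [hgdef, hx, hy, if_true, if_false]
      · simp
      · have := hamin x hx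
        rw [hoff y hy, abs_of_nonneg (by linarith), abs_of_nonneg (by linarith),
          abs_of_nonneg (by norm_num)]
        ring
      · have := hamin y hy
        rw [hoff x hx, abs_of_nonpos (by linarith), abs_of_nonpos (by linarith),
          abs_of_nonpos (by norm_num)]
        ring
      · simp
    rw [key]
    ring
  have hsum : ∑ x, f x = ∑ x, g x + f a * A.card := by
    simp only [hgdef, Finset.sum_sub_distrib, ← Finset.mul_sum]
    simp
  rw [hvar, hsum, mul_add]
  have := mul_le_mul_of_nonneg_left h2 ha.le
  linarith

/-- Cheeger's inequality for non-negative functions with small support. -/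
theorem sq_mul_sum_sq_le_energy {G : SimpleGraph V} {D : ℕ}
    (hD : ∀ v, (G.neighborSet v).ncard ≤ D) {c : ℝ} (hc : 0 ≤ c) (k : ℕ)
    (hiso : ∀ A : Finset V, A.card ≤ k → c * A.card ≤ (boundary G A).card) (f : V → ℝ)
    (hf : ∀ x, 0 ≤ f x) (hk : {x | 0 < f x}.ncard ≤ k) :
    c ^ 2 * ∑ x, f x ^ 2 ≤ 4 * D * energy G f := by
  classical
  have hS : 0 ≤ ∑ x, f x ^ 2 := Finset.sum_nonneg fun x _ => sq_nonneg _
  have h1 : c * ∑ x, f x ^ 2 ≤ variation G fun x => f x ^ 2 := by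
    refine mul_sum_le_variation k hiso _ (fun x => sq_nonneg _) (le_trans ?_ hk)
    rw [Set.ncard_eq_toFinset_card']
    refine Finset.card_le_card fun x hx => ?_
    simp only [Finset.mem_filter, Finset.mem_univ, true_and, Set.mem_toFinset,
      Set.mem_ofPred_eq] at hx ⊢
    exact lt_of_le_of_ne (hf x) fun h => by simp [← h] at hx
  -- Cauchy–Schwarz for `|f x ^ 2 - f y ^ 2| = |f x - f y| * |f x + f y|`.
  have h2 : (variation G fun x => f x ^ 2) ^ 2 ≤
      energy G f * ∑ x, ∑ y, adj G x y * (f x + f y) ^ 2 := by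
    unfold variation energy
    simp only [← Fintype.sum_prod_type']
    refine Finset.sum_sq_le_sum_mul_sum_of_sq_le_mul _
      (fun p _ => mul_nonneg (adj_nonneg G _ _) (sq_nonneg _))
      (fun p _ => mul_nonneg (adj_nonneg G _ _) (sq_nonneg _)) fun p _ => ?_
    rw [mul_pow, sq_abs]
    exact le_of_eq (by ring)
  have h3 : ∑ x, ∑ y, adj G x y * (f x + f y) ^ 2 ≤ 4 * D * ∑ x, f x ^ 2 := by
    calc ∑ x, ∑ y, adj G x y * (f x + f y) ^ 2
        ≤ ∑ x, ∑ y, (2 * (adj G x y * f x ^ 2) + 2 * (adj G x y * f y ^ 2)) := by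
          gcongr with x _ y _
          nlinarith [mul_nonneg (adj_nonneg G x y) (sq_nonneg (f x - f y))]
      _ = 4 * ∑ x, ∑ y, adj G x y * f x ^ 2 := by
          simp only [Finset.sum_add_distrib, ← Finset.mul_sum]
          rw [sum_sum_adj_comm G fun x y => f y ^ 2]
          ring
      _ ≤ 4 * (D * ∑ x, f x ^ 2) := by
          gcongr
          exact sum_sum_adj_mul_le hD fun x => sq_nonneg (f x)
      _ = _ := by ring
  have hE := energy_nonneg G f
  have h4 : (c * ∑ x, f x ^ 2) ^ 2 ≤ energy G f * (4 * D * ∑ x, f x ^ 2) :=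
    (pow_le_pow_left₀ (mul_nonneg hc hS) h1 2).trans
      (h2.trans (mul_le_mul_of_nonneg_left h3 hE))
  rcases hS.eq_or_lt with h0 | hpos
  · rw [← h0, mul_zero]; positivity
  · refine le_of_mul_le_mul_right ?_ hpos
    linarith [h4, show (c * ∑ x, f x ^ 2) ^ 2 = c ^ 2 * (∑ x, f x ^ 2) * ∑ x, f x ^ 2 by ring]

/-- Every function on a finite non-empty set has a median. -/
theorem exists_median [Nonempty V] (f : V → ℝ) :
    ∃ m : ℝ, 2 * {x | m < f x}.ncard ≤ Fintype.card V ∧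
      2 * {x | f x < m}.ncard ≤ Fintype.card V := by
  classical
  let S : Finset V := Finset.univ.filter fun x => 2 * {y | f x < f y}.ncard ≤ Fintype.card V
  have hS : ∀ x, x ∈ S ↔ 2 * {y | f x < f y}.ncard ≤ Fintype.card V := by simp [S]
  obtain ⟨t, ht⟩ := Finite.exists_max f
  have hne : S.Nonempty := ⟨t, by
    rw [hS, show {y | f t < f y} = ∅ from Set.eq_empty_of_forall_notMem fun y hy =>
      absurd (ht y) (not_le.2 hy)]
    simp⟩
  obtain ⟨x, hx, hmin⟩ := S.exists_min_image f hne
  refine ⟨f x, (hS x).1 hx, ?_⟩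
  -- Here `f x` is the least value with at most half of the vertices strictly above it. If more than
  -- half lay below, the next smaller value would also qualify.
  by_contra! hlt
  have hne' : {z | f z < f x}.Nonempty := by
    rw [← Set.ncard_pos]
    omega
  obtain ⟨y, hy, hymax⟩ := Set.exists_max_image _ f (Set.toFinite _) hne'
  have hsub : {z | f y < f z} ⊆ {z | f z < f x}ᶜ := fun z hz hz' =>
    absurd (hymax z hz') (not_le.2 hz)
  have h1 := Set.ncard_le_ncard hsub
  have h2 := Set.ncard_add_ncard_compl {z | f z < f x}
  rw [Nat.card_eq_fintype_card] at h2
  exact absurd (hmin y ((hS y).2 (by omega))) (not_le.2 hy)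

/-- Along each edge, `f x - f y` is a sum of two terms of the same sign, coming from the parts above
and below `m`; the dropped cross term is non-negative. -/
theorem energy_posPart_add_energy_negPart_le (G : SimpleGraph V) (f : V → ℝ) (m : ℝ) :
    (energy G fun x => max (f x - m) 0) + (energy G fun x => max (m - f x) 0) ≤ energy G f := by
  unfold energy
  simp only [← Finset.sum_add_distrib, ← mul_add]
  gcongr with x _ y _
  · exact adj_nonneg G x y
  rcases le_total (f x) m with hx | hx <;> rcases le_total (f y) m with hy | hy
  · rw [max_eq_right (by linarith), max_eq_right (by linarith), max_eq_left (by linarith),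
      max_eq_left (by linarith)]
    nlinarith
  · rw [max_eq_right (by linarith), max_eq_left (by linarith), max_eq_left (by linarith),
      max_eq_right (by linarith)]
    nlinarith
  · rw [max_eq_left (by linarith), max_eq_right (by linarith), max_eq_right (by linarith),
      max_eq_left (by linarith)]
    nlinarith
  · rw [max_eq_left (by linarith), max_eq_left (by linarith), max_eq_right (by linarith),
      max_eq_right (by linarith)]
    nlinarith

/-- Cheeger's inequality: expanders have a spectral gap. -/
theorem IsExpander.sq_mul_sum_sq_le_energy {G : SimpleGraph V} {D : ℕ}
    (hD : ∀ v, (G.neighborSet v).ncard ≤ D) {c : ℝ} (hc : 0 ≤ c) (hG : IsExpander G c)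
    (f : V → ℝ) (hf : ∑ x, f x = 0) : c ^ 2 * ∑ x, f x ^ 2 ≤ 4 * D * energy G f := by
  rcases isEmpty_or_nonempty V with hV | hV
  · simp [energy]
  obtain ⟨m, hm1, hm2⟩ := exists_median f
  have hiso : ∀ A : Finset V, A.card ≤ Fintype.card V / 2 →
      c * A.card ≤ (boundary G A).card := fun A hA => by
    rcases A.eq_empty_or_nonempty with rfl | hne
    · simp
    by_contra! hlt
    refine hG A hne ⟨?_, hlt.le⟩
    rw [le_div_iff₀ two_pos]
    exact_mod_cast (by omega : A.card * 2 ≤ Fintype.card V)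
  have h1 := CoarseGraph.sq_mul_sum_sq_le_energy hD hc _ hiso (fun x => max (f x - m) 0)
    (fun x => le_max_right _ _) (by
      rw [show {x | 0 < max (f x - m) 0} = {x | m < f x} by ext x; simp]; omega)
  have h2 := CoarseGraph.sq_mul_sum_sq_le_energy hD hc _ hiso (fun x => max (m - f x) 0)
    (fun x => le_max_right _ _) (by
      rw [show {x | 0 < max (m - f x) 0} = {x | f x < m} by ext x; simp]; omega)
  have h3 := energy_posPart_add_energy_negPart_le G f m
  have h4 : ∑ x, max (f x - m) 0 ^ 2 + ∑ x, max (m - f x) 0 ^ 2 = ∑ x, (f x - m) ^ 2 := by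
    rw [← Finset.sum_add_distrib]
    refine Finset.sum_congr rfl fun x _ => ?_
    rcases le_total (f x) m with hx | hx
    · rw [max_eq_right (by linarith), max_eq_left (by linarith)]; ring
    · rw [max_eq_left (by linarith), max_eq_right (by linarith)]; ring
  -- The mean, here `0`, minimises the sum of squared deviations.
  have h5 : ∑ x, f x ^ 2 ≤ ∑ x, (f x - m) ^ 2 := by
    have : ∑ x, (f x - m) ^ 2 = ∑ x, f x ^ 2 - 2 * m * ∑ x, f x + ∑ _x : V, m ^ 2 := by
      rw [Finset.mul_sum, ← Finset.sum_sub_distrib, ← Finset.sum_add_distrib]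
      exact Finset.sum_congr rfl fun x _ => by ring
    rw [this, hf]
    have : 0 ≤ ∑ _x : V, m ^ 2 := Finset.sum_nonneg fun _ _ => sq_nonneg m
    linarith
  calc c ^ 2 * ∑ x, f x ^ 2 ≤ c ^ 2 * ∑ x, (f x - m) ^ 2 := by gcongr
    _ ≤ 4 * D * ((energy G fun x => max (f x - m) 0) + (energy G fun x => max (m - f x) 0)) := by
      rw [← h4]; linarith
    _ ≤ 4 * D * energy G f := by gcongr

end CheegerInequality

/-! ### Spectral contraction of the lazy walk -/

section LazyWalk

variable {V : Type*} [Fintype V]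

/-- The averaging operator `1 - Δ / (2D)` of a graph, `Δ` being the graph Laplacian. -/
noncomputable def lazyWalk {𝕜 : Type*} [RCLike 𝕜] (G : SimpleGraph V) (D : ℕ) :
    (V → 𝕜) →ₗ[𝕜] (V → 𝕜) where
  toFun f x := f x - (2 * D : 𝕜)⁻¹ * ∑ y, (adj G x y : 𝕜) * (f x - f y)
  map_add' f g := by
    ext x
    simp only [Pi.add_apply, add_sub_add_comm, mul_add, Finset.sum_add_distrib]
  map_smul' a f := by
    ext x
    simp only [Pi.smul_apply, smul_eq_mul, RingHom.id_apply, ← mul_sub, mul_left_comm _ a,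
      ← Finset.mul_sum]

theorem lazyWalk_apply {𝕜 : Type*} [RCLike 𝕜] (G : SimpleGraph V) (D : ℕ) (f : V → 𝕜) (x : V) :
    lazyWalk G D f x = f x - (2 * D : 𝕜)⁻¹ * ∑ y, (adj G x y : 𝕜) * (f x - f y) := rfl

theorem lazyWalk_const {𝕜 : Type*} [RCLike 𝕜] (G : SimpleGraph V) (D : ℕ) (a : 𝕜) (x : V) :
    lazyWalk G D (fun _ => a) x = a := by
  simp [lazyWalk_apply]

theorem sum_lazyWalk {𝕜 : Type*} [RCLike 𝕜] (G : SimpleGraph V) (D : ℕ) (f : V → 𝕜) :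
    ∑ x, lazyWalk G D f x = ∑ x, f x := by
  simp only [lazyWalk_apply, Finset.sum_sub_distrib, ← Finset.mul_sum]
  have h : ∑ x, ∑ y, (adj G x y : 𝕜) * (f x - f y) = 0 := by
    simp only [mul_sub, Finset.sum_sub_distrib]
    rw [sub_eq_zero]
    conv_rhs => rw [Finset.sum_comm]
    simp only [adj_comm G]
  rw [h, mul_zero, sub_zero]

/-- Real coefficients let the complex estimates be read off from the real ones. -/
theorem re_lazyWalk (G : SimpleGraph V) (D : ℕ) (f : V → ℂ) (x : V) :
    (lazyWalk G D f x).re = lazyWalk G D (fun y => (f y).re) x := by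
  have h : (2 * D : ℂ)⁻¹ = (((2 * D : ℝ)⁻¹ : ℝ) : ℂ) := by push_cast; rfl
  simp only [lazyWalk_apply, h, Complex.coe_algebraMap, RCLike.ofReal_real_eq_id, id_eq,
    Complex.sub_re, Complex.re_ofReal_mul, Complex.re_sum]

theorem im_lazyWalk (G : SimpleGraph V) (D : ℕ) (f : V → ℂ) (x : V) :
    (lazyWalk G D f x).im = lazyWalk G D (fun y => (f y).im) x := by
  have h : (2 * D : ℂ)⁻¹ = (((2 * D : ℝ)⁻¹ : ℝ) : ℂ) := by push_cast; rfl
  simp only [lazyWalk_apply, h, Complex.coe_algebraMap, RCLike.ofReal_real_eq_id, id_eq,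
    Complex.sub_im, Complex.im_ofReal_mul, Complex.im_sum]

theorem sum_mul_laplacian (G : SimpleGraph V) (f : V → ℝ) :
    2 * ∑ x, f x * ∑ y, adj G x y * (f x - f y) = energy G f := by
  have h1 : ∑ x, f x * ∑ y, adj G x y * (f x - f y) =
      ∑ x, ∑ y, adj G x y * (f x * (f x - f y)) := by
    simp only [Finset.mul_sum, mul_left_comm]
  have h2 := sum_sum_adj_comm G fun x y => f x * (f x - f y)
  rw [two_mul, h1]
  conv_lhs =>
    arg 2
    rw [h2]
  unfold energy
  rw [← Finset.sum_add_distrib]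
  refine Finset.sum_congr rfl fun x _ => ?_
  rw [← Finset.sum_add_distrib]
  exact Finset.sum_congr rfl fun y _ => by ring

theorem sum_sq_laplacian_le {G : SimpleGraph V} {D : ℕ} (hD : ∀ v, (G.neighborSet v).ncard ≤ D)
    (f : V → ℝ) : ∑ x, (∑ y, adj G x y * (f x - f y)) ^ 2 ≤ D * energy G f := by
  unfold energy
  rw [Finset.mul_sum]
  gcongr with x
  calc (∑ y, adj G x y * (f x - f y)) ^ 2
      ≤ (∑ y, adj G x y) * ∑ y, adj G x y * (f x - f y) ^ 2 :=
        Finset.sum_sq_le_sum_mul_sum_of_sq_le_mul _ (fun y _ => adj_nonneg G x y)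
          (fun y _ => mul_nonneg (adj_nonneg G x y) (sq_nonneg _)) fun y _ => le_of_eq (by ring)
    _ ≤ D * ∑ y, adj G x y * (f x - f y) ^ 2 :=
        mul_le_mul_of_nonneg_right (sum_adj_le hD x) <|
          Finset.sum_nonneg fun y _ => mul_nonneg (adj_nonneg G x y) (sq_nonneg _)

/-- Expand the square: the cross term contributes `-energy / (2D)`, and the quadratic term at most
`energy / (4D)`, because `‖Δf‖² ≤ D * energy`. -/
theorem sum_sq_lazyWalk_le {G : SimpleGraph V} {D : ℕ} (hD : ∀ v, (G.neighborSet v).ncard ≤ D)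
    (hD0 : 0 < D) (f : V → ℝ) :
    ∑ x, lazyWalk G D f x ^ 2 ≤ ∑ x, f x ^ 2 - energy G f / (4 * D) := by
  have hD' : (0 : ℝ) < D := by exact_mod_cast hD0
  have h1 := sum_mul_laplacian G f
  have h2 := sum_sq_laplacian_le hD f
  have h3 : ∑ x, lazyWalk G D f x ^ 2 = ∑ x, f x ^ 2 -
      (D : ℝ)⁻¹ * ∑ x, f x * ∑ y, adj G x y * (f x - f y) +
      (4 * D ^ 2 : ℝ)⁻¹ * ∑ x, (∑ y, adj G x y * (f x - f y)) ^ 2 := by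
    rw [Finset.mul_sum, Finset.mul_sum, ← Finset.sum_sub_distrib, ← Finset.sum_add_distrib]
    refine Finset.sum_congr rfl fun x _ => ?_
    rw [lazyWalk_apply]
    simp only [RCLike.ofReal_real_eq_id, id_eq]
    field_simp
    ring
  have h4 : (4 * D ^ 2 : ℝ)⁻¹ * ∑ x, (∑ y, adj G x y * (f x - f y)) ^ 2 ≤
      (4 * D ^ 2 : ℝ)⁻¹ * (D * energy G f) := by gcongr
  rw [h3, show ∑ x, f x * ∑ y, adj G x y * (f x - f y) = energy G f / 2 by linarith]
  have h5 : (4 * D ^ 2 : ℝ)⁻¹ * (D * energy G f) = energy G f / (4 * D) := by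
    field_simp
  have h6 : (D : ℝ)⁻¹ * (energy G f / 2) = 2 * (energy G f / (4 * D)) := by
    field_simp
    norm_num
  linarith

theorem sum_norm_sq_eq (f : V → ℂ) :
    ∑ x, ‖f x‖ ^ 2 = ∑ x, (f x).re ^ 2 + ∑ x, (f x).im ^ 2 := by
  rw [← Finset.sum_add_distrib]
  refine Finset.sum_congr rfl fun x _ => ?_
  rw [Complex.sq_norm, Complex.normSq_apply]
  ring

theorem sum_norm_sq_lazyWalk_le {G : SimpleGraph V} {D : ℕ}
    (hD : ∀ v, (G.neighborSet v).ncard ≤ D) (hD0 : 0 < D) (f : V → ℂ) :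
    ∑ x, ‖lazyWalk G D f x‖ ^ 2 ≤ ∑ x, ‖f x‖ ^ 2 := by
  simp only [sum_norm_sq_eq, re_lazyWalk, im_lazyWalk]
  have h1 := sum_sq_lazyWalk_le hD hD0 fun y => (f y).re
  have h2 := sum_sq_lazyWalk_le hD hD0 fun y => (f y).im
  have h3 : 0 ≤ (energy G fun y => (f y).re) / (4 * D) :=
    div_nonneg (energy_nonneg _ _) (by positivity)
  have h4 : 0 ≤ (energy G fun y => (f y).im) / (4 * D) :=
    div_nonneg (energy_nonneg _ _) (by positivity)
  linarith

/-- Subtracting the mean commutes with the walk, and on mean-zero functions Cheeger's inequality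
turns the energy loss into the factor `1 - c ^ 2 / (16 * D ^ 2)`. A non-negative `q` above it allows
passing back from `g` to `f`. -/
theorem IsExpander.sum_sq_lazyWalk_sub_le {G : SimpleGraph V} {D : ℕ}
    (hD : ∀ v, (G.neighborSet v).ncard ≤ D) (hD0 : 0 < D) {c : ℝ} (hc : 0 ≤ c)
    (hG : IsExpander G c) {q : ℝ} (hq : 1 - c ^ 2 / (16 * D ^ 2) ≤ q) (hq0 : 0 ≤ q) (f : V → ℝ) :
    ∑ x, (lazyWalk G D f x - (∑ y, f y) / Fintype.card V) ^ 2 ≤ q * ∑ x, f x ^ 2 := by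
  rcases isEmpty_or_nonempty V with hV | hV
  · simp
  have hD' : (0 : ℝ) < D := by exact_mod_cast hD0
  have hN : (0 : ℝ) < Fintype.card V := by exact_mod_cast Fintype.card_pos
  set a : ℝ := (∑ y, f y) / Fintype.card V with ha
  have hsum : ∑ y, f y = Fintype.card V * a := by rw [ha]; field_simp
  let g : V → ℝ := f - fun _ => a
  have hg : ∀ x, lazyWalk G D f x - a = lazyWalk G D g x := fun x => by
    rw [map_sub, Pi.sub_apply, lazyWalk_const]
  have hg0 : ∑ x, g x = 0 := by
    simp [g, hsum]
  have h1 := sum_sq_lazyWalk_le hD hD0 g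
  have h2 := hG.sq_mul_sum_sq_le_energy hD hc g hg0
  have h3 : ∑ x, g x ^ 2 ≤ ∑ x, f x ^ 2 := by
    have : ∑ x, g x ^ 2 = ∑ x, f x ^ 2 - 2 * a * ∑ x, f x + ∑ _x : V, a ^ 2 := by
      rw [Finset.mul_sum, ← Finset.sum_sub_distrib, ← Finset.sum_add_distrib]
      exact Finset.sum_congr rfl fun x _ => by simp only [g, Pi.sub_apply]; ring
    rw [this, hsum, Finset.sum_const, Finset.card_univ, nsmul_eq_mul]
    nlinarith [mul_nonneg hN.le (sq_nonneg a)]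
  have h4 : c ^ 2 / (16 * D ^ 2) * ∑ x, g x ^ 2 ≤ energy G g / (4 * D) := by
    rw [div_mul_eq_mul_div, div_le_div_iff₀ (by positivity) (by positivity)]
    nlinarith [mul_le_mul_of_nonneg_left h2 (by positivity : (0 : ℝ) ≤ 4 * D)]
  have hS : 0 ≤ ∑ x, g x ^ 2 := Finset.sum_nonneg fun x _ => sq_nonneg _
  simp only [hg]
  calc ∑ x, lazyWalk G D g x ^ 2 ≤ (1 - c ^ 2 / (16 * D ^ 2)) * ∑ x, g x ^ 2 := by linarith
    _ ≤ q * ∑ x, g x ^ 2 := by gcongr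
    _ ≤ q * ∑ x, f x ^ 2 := by gcongr

theorem IsExpander.sum_norm_sq_lazyWalk_sub_le {G : SimpleGraph V} {D : ℕ}
    (hD : ∀ v, (G.neighborSet v).ncard ≤ D) (hD0 : 0 < D) {c : ℝ} (hc : 0 ≤ c)
    (hG : IsExpander G c) {q : ℝ} (hq : 1 - c ^ 2 / (16 * D ^ 2) ≤ q) (hq0 : 0 ≤ q) (f : V → ℂ) :
    ∑ x, ‖lazyWalk G D f x - (∑ y, f y) / Fintype.card V‖ ^ 2 ≤ q * ∑ x, ‖f x‖ ^ 2 := by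
  have h1 := hG.sum_sq_lazyWalk_sub_le hD hD0 hc hq hq0 fun y => (f y).re
  have h2 := hG.sum_sq_lazyWalk_sub_le hD hD0 hc hq hq0 fun y => (f y).im
  rw [sum_norm_sq_eq, sum_norm_sq_eq f]
  simp only [Complex.sub_re, Complex.sub_im, re_lazyWalk, im_lazyWalk, Complex.div_natCast_re,
    Complex.div_natCast_im, Complex.re_sum, Complex.im_sum]
  linarith

end LazyWalk

/-! ### Characteristic vectors and matrix blocks -/

section Vectors

variable {X : Type*}

open Classical in
theorem delta_apply (x y : X) : (delta y : L2 X) x = if x = y then 1 else 0 := by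
  split_ifs with h
  · subst h
    rw [← inner_delta, delta, lp.inner_single_left]
    simp
  · exact delta_apply_ne h

theorem inner_chi (F : Finset X) (f : L2 X) : ⟪chi F, f⟫_ℂ = ∑ x ∈ F, f x := by
  rw [chi, sum_inner]
  simp only [inner_delta]

open Classical in
theorem chi_apply (F : Finset X) (x : X) : (chi F : L2 X) x = if x ∈ F then 1 else 0 := by
  rw [← inner_delta, chi, inner_sum]
  simp only [inner_delta, delta_apply]
  simp

theorem norm_sq_chi (F : Finset X) : ‖(chi F : L2 X)‖ ^ 2 = F.card := by
  have h : ⟪(chi F : L2 X), chi F⟫_ℂ = F.card := by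
    rw [inner_chi, Finset.sum_congr rfl fun x hx => by rw [chi_apply, if_pos hx]]
    simp
  rw [← inner_self_eq_norm_sq (𝕜 := ℂ), h]
  simp

theorem inner_chi_apply_chi (T : L2 X →L[ℂ] L2 X) (A B : Finset X) :
    ⟪chi B, T (chi A)⟫_ℂ = ∑ x ∈ B, ∑ y ∈ A, coeff T x y := by
  rw [inner_chi]
  refine Finset.sum_congr rfl fun x _ => ?_
  rw [← inner_delta, chi, map_sum, inner_sum]
  simp only [inner_delta, coeff]

/-- The double sum is `⟪χ_B, T χ_A⟫`. This is how a large block of equal entries forces a lower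
bound on the norm. -/
theorem norm_sum_coeff_sq_le (T : L2 X →L[ℂ] L2 X) (A B : Finset X) :
    ‖∑ x ∈ B, ∑ y ∈ A, coeff T x y‖ ^ 2 ≤ ‖T‖ ^ 2 * (A.card * B.card) := by
  rw [← inner_chi_apply_chi, ← norm_sq_chi A, ← norm_sq_chi B, ← mul_pow, ← mul_pow]
  gcongr
  calc ‖⟪chi B, T (chi A)⟫_ℂ‖ ≤ ‖(chi B : L2 X)‖ * ‖T (chi A)‖ := norm_inner_le_norm _ _
    _ ≤ ‖(chi B : L2 X)‖ * (‖T‖ * ‖(chi A : L2 X)‖) := by gcongr; exact T.le_opNorm _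
    _ = _ := by ring

theorem finsetAveragingProjection_apply (F : Finset X) (f : L2 X) :
    finsetAveragingProjection F f = ((∑ x ∈ F, f x) / F.card) • chi F := by
  rw [finsetAveragingProjection, Submodule.starProjection_singleton, inner_chi]
  rw [norm_sq_chi, RCLike.ofReal_natCast]

theorem hasSum_norm_sq (f : L2 X) : HasSum (fun x => ‖f x‖ ^ 2) (‖f‖ ^ 2) := by
  have h := lp.hasSum_norm (p := 2) (by norm_num) f
  simpa using h

end Vectors

/-! ### Block-diagonal operators on the disjoint union -/

section Blocks

variable {V : ℕ → Type*} [∀ n, Fintype (V n)]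

theorem averagingProjection_apply (f : L2 (Σ n, V n)) (n : ℕ) (x : V n) :
    averagingProjection V f ⟨n, x⟩ = (∑ y, f ⟨n, y⟩) / Fintype.card (V n) := by
  classical
  have h := (hasSum_averagingProjection V f).mapL (innerSL ℂ (delta ⟨n, x⟩))
  simp only [innerSL_apply_apply, inner_delta] at h
  have hval : finsetAveragingProjection (piece V n) f ⟨n, x⟩ =
      (∑ y, f ⟨n, y⟩) / Fintype.card (V n) := by
    rw [finsetAveragingProjection_apply, lp.coeFn_smul, Pi.smul_apply, chi_apply, if_pos]
    · simp [piece]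
    · simp [piece]
  have hsingle := hasSum_single (f := fun m => finsetAveragingProjection (piece V m) f ⟨n, x⟩) n
    fun m hm => by
      rw [finsetAveragingProjection_apply, lp.coeFn_smul, Pi.smul_apply, chi_apply, if_neg,
        smul_zero]
      simp only [piece, Finset.mem_map, Finset.mem_univ, true_and]
      rintro ⟨y, hy⟩
      exact hm (congrArg Sigma.fst hy)
  rw [← hval]
  exact h.unique hsingle

theorem hasSum_sum_norm_sq (f : L2 (Σ n, V n)) :
    HasSum (fun n => ∑ x, ‖f ⟨n, x⟩‖ ^ 2) (‖f‖ ^ 2) :=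
  (hasSum_norm_sq f).sigma fun n => hasSum_fintype fun x : V n => ‖f ⟨n, x⟩‖ ^ 2

theorem norm_sq_le_of_blocks {q : ℝ} {f g : L2 (Σ n, V n)}
    (h : ∀ n, ∑ x, ‖g ⟨n, x⟩‖ ^ 2 ≤ q * ∑ x, ‖f ⟨n, x⟩‖ ^ 2) : ‖g‖ ^ 2 ≤ q * ‖f‖ ^ 2 :=
  hasSum_le h (hasSum_sum_norm_sq g) ((hasSum_sum_norm_sq f).mul_left q)

theorem memℓp_two_of_blocks (g : ∀ n, V n → ℂ) (f : L2 (Σ n, V n))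
    (h : ∀ n, ∑ x, ‖g n x‖ ^ 2 ≤ ∑ x, ‖f ⟨n, x⟩‖ ^ 2) :
    Memℓp (fun p : Σ n, V n => g p.1 p.2) 2 := by
  refine memℓp_gen ?_
  simp only [ENNReal.toReal_ofNat, Real.rpow_ofNat]
  rw [summable_sigma_of_nonneg fun p => by positivity]
  refine ⟨fun n => (hasSum_fintype _).summable, ?_⟩
  simp only [tsum_fintype]
  exact Summable.of_nonneg_of_le (fun n => by positivity) h (hasSum_sum_norm_sq f).summable

/-- The direct sum of a family of contractions of the `ℓ²(X_n)`, as a linear map. -/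
noncomputable def blockLinearMap (L : ∀ n, (V n → ℂ) →ₗ[ℂ] (V n → ℂ))
    (hL : ∀ n f, ∑ x, ‖L n f x‖ ^ 2 ≤ ∑ x, ‖f x‖ ^ 2) : L2 (Σ n, V n) →ₗ[ℂ] L2 (Σ n, V n) where
  toFun f := ⟨fun p => L p.1 (fun y => f ⟨p.1, y⟩) p.2,
    memℓp_two_of_blocks (fun n => L n fun y => f ⟨n, y⟩) f fun n => hL n _⟩
  map_add' f g := by
    ext p
    exact congrFun ((L p.1).map_add (fun y => f ⟨p.1, y⟩) fun y => g ⟨p.1, y⟩) p.2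
  map_smul' a f := by
    ext p
    exact congrFun ((L p.1).map_smul a fun y => f ⟨p.1, y⟩) p.2

theorem norm_blockLinearMap_le (L : ∀ n, (V n → ℂ) →ₗ[ℂ] (V n → ℂ))
    (hL : ∀ n f, ∑ x, ‖L n f x‖ ^ 2 ≤ ∑ x, ‖f x‖ ^ 2) (f : L2 (Σ n, V n)) :
    ‖blockLinearMap L hL f‖ ≤ 1 * ‖f‖ := by
  rw [one_mul]
  refine le_of_sq_le_sq ?_ (norm_nonneg f)
  rw [← one_mul (‖f‖ ^ 2)]
  refine norm_sq_le_of_blocks fun n => ?_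
  rw [one_mul]
  exact hL n fun y => f ⟨n, y⟩

/-- The direct sum of a family of contractions of the `ℓ²(X_n)`. -/
noncomputable def blockOperator (L : ∀ n, (V n → ℂ) →ₗ[ℂ] (V n → ℂ))
    (hL : ∀ n f, ∑ x, ‖L n f x‖ ^ 2 ≤ ∑ x, ‖f x‖ ^ 2) : L2 (Σ n, V n) →L[ℂ] L2 (Σ n, V n) :=
  (blockLinearMap L hL).mkContinuous 1 (norm_blockLinearMap_le L hL)

theorem blockOperator_apply (L : ∀ n, (V n → ℂ) →ₗ[ℂ] (V n → ℂ))
    (hL : ∀ n f, ∑ x, ‖L n f x‖ ^ 2 ≤ ∑ x, ‖f x‖ ^ 2) (f : L2 (Σ n, V n)) (n : ℕ) (x : V n) :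
    blockOperator L hL f ⟨n, x⟩ = L n (fun y => f ⟨n, y⟩) x := rfl

end Blocks

/-! ### The two implications -/

section Equivalence

variable {V : ℕ → Type*} [∀ n, Fintype (V n)]

theorem coeff_averagingProjection (n : ℕ) (x y : V n) :
    coeff (averagingProjection V) ⟨n, x⟩ ⟨n, y⟩ = (Fintype.card (V n) : ℂ)⁻¹ := by
  classical
  rw [coeff, averagingProjection_apply]
  simp [delta_apply]

theorem averagingProjection_mul_self :
    averagingProjection V * averagingProjection V = averagingProjection V :=
  (Submodule.isIdempotentElem_starProjection _).eq

theorem exists_expander_of_averagingProjection_mem {G : ∀ n, SimpleGraph (V n)}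
    [MetricSpace (Σ n, V n)] (hG : ∀ n, (G n).Connected) (hdeg : UniformlyBoundedDegree G)
    (hmany : ∀ n, HasManyMaximalCheegerSets (G n)) (hX : IsCoarseDisjointUnion G)
    (hP : averagingProjection V ∈ uniformRoeAlgebra (Σ n, V n)) :
    ∃ c : ℝ, 0 < c ∧ ∀ n, IsExpander (G n) c := by
  obtain ⟨D, hD⟩ := hdeg
  obtain ⟨T, ⟨R, hR⟩, hT⟩ := Metric.mem_closure_iff.1 hP (1 / 4) (by norm_num)
  rw [dist_eq_norm] at hT
  set k := ⌈R⌉₊ with hk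
  set K := ∑ i ∈ Finset.range k, D ^ i with hK
  -- Chosen so that `K * |∂A| ≤ |A| / 4` for a Cheeger set `A`; the `+ 1` covers `K = 0`.
  refine ⟨1 / (4 * (K + 1)), by positivity, fun n A₀ hne hA₀ => ?_⟩
  have hV : 0 < (Fintype.card (V n) : ℝ) := by
    have := (hG n).nonempty
    exact_mod_cast Fintype.card_pos
  have hpos : (0 : ℝ) < A₀.card := by exact_mod_cast hne.card_pos
  have hh : cheegerConst (G n) ≤ 1 / (4 * (K + 1)) :=
    (cheegerConst_le _ ⟨hne.card_pos, hA₀.1⟩).trans ((div_le_iff₀ hpos).2 hA₀.2)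
  -- `A₀` may be tiny and serves only to bound `h`; the large Cheeger set replaces it.
  obtain ⟨A, hA, hlarge⟩ := (hmany n).exists_large
  classical
  set B : Finset (V n) := ((closedNbhd (G n))^[k] A)ᶜ with hB
  have hAB : ((closedNbhd (G n))^[k] A).card ≤ (5 / 4 : ℝ) * A.card := by
    have h1 : (((closedNbhd (G n))^[k] A).card : ℝ) ≤ A.card + K * (boundary (G n) A).card := by
      exact_mod_cast iterate_closedNbhd_card_le (hD n) k A
    have h2 : (K : ℝ) * (boundary (G n) A).card ≤ 1 / 4 * A.card := by
      rw [hA.card_boundary, ← mul_assoc]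
      gcongr
      calc (K : ℝ) * cheegerConst (G n) ≤ K * (1 / (4 * (K + 1))) := by gcongr
        _ ≤ 1 / 4 := by
          rw [mul_one_div, div_le_div_iff₀ (by positivity) (by norm_num)]
          linarith
    linarith
  have hBcard : (3 / 8 : ℝ) * Fintype.card (V n) ≤ B.card := by
    have h1 : (((closedNbhd (G n))^[k] A).card : ℝ) + B.card = Fintype.card (V n) := by
      exact_mod_cast Finset.card_add_card_compl _
    linarith [hA.1.2]
  have hcoeff : ∀ x ∈ B, ∀ y ∈ A, coeff (averagingProjection V - T) ⟨n, x⟩ ⟨n, y⟩ =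
      (Fintype.card (V n) : ℂ)⁻¹ := fun x hx y hy => by
    have hzero : coeff T ⟨n, x⟩ ⟨n, y⟩ = 0 := by
      by_contra hne
      have hd := hR _ _ hne
      rw [hX.dist_same, SimpleGraph.dist_comm] at hd
      refine Finset.mem_compl.1 hx (mem_iterate_closedNbhd_of_dist_le (hG n) hy ?_)
      exact_mod_cast hd.trans (Nat.le_ceil R)
    have hsub : coeff (averagingProjection V - T) ⟨n, x⟩ ⟨n, y⟩ =
        coeff (averagingProjection V) ⟨n, x⟩ ⟨n, y⟩ - coeff T ⟨n, x⟩ ⟨n, y⟩ := by simp [coeff]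
    rw [hsub, hzero, sub_zero, coeff_averagingProjection]
  have hnorm := norm_sum_coeff_sq_le (averagingProjection V - T)
    (A.map (Function.Embedding.sigmaMk n)) (B.map (Function.Embedding.sigmaMk n))
  simp only [Finset.sum_map, Finset.card_map, Function.Embedding.sigmaMk_apply] at hnorm
  rw [Finset.sum_congr rfl fun x hx => Finset.sum_congr rfl fun y hy => hcoeff x hx y hy] at hnorm
  simp only [Finset.sum_const, nsmul_eq_mul, norm_mul, norm_inv, Complex.norm_natCast] at hnorm
  have hsmall : ‖averagingProjection V - T‖ ^ 2 ≤ (1 / 4) ^ 2 :=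
    pow_le_pow_left₀ (norm_nonneg _) hT.le 2
  have hprod : (3 / 32 : ℝ) * (Fintype.card (V n)) ^ 2 ≤ A.card * B.card := by
    calc (3 / 32 : ℝ) * (Fintype.card (V n)) ^ 2 =
        (Fintype.card (V n) / 4) * (3 / 8 * Fintype.card (V n)) := by ring
      _ ≤ A.card * B.card := by gcongr
  have hprod_pos : (0 : ℝ) < A.card * B.card := lt_of_lt_of_le (by positivity) hprod
  have h1 := hnorm.trans (mul_le_mul_of_nonneg_right hsmall hprod_pos.le)
  have h2 : ((B.card : ℝ) * (A.card * (Fintype.card (V n) : ℝ)⁻¹)) ^ 2 =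
      (A.card * B.card) / (Fintype.card (V n)) ^ 2 * (A.card * B.card) := by
    field_simp
  rw [h2] at h1
  have h3 := le_of_mul_le_mul_right h1 hprod_pos
  rw [div_le_iff₀ (by positivity)] at h3
  -- The contradiction is `3 / 32 > (1 / 4) ^ 2`, which dictated the approximation error `1 / 4`.
  nlinarith [pow_pos hV 2]

theorem IsExpanderSequence.averagingProjection_mem {G : ∀ n, SimpleGraph (V n)}
    [MetricSpace (Σ n, V n)] (hX : IsCoarseDisjointUnion G) (hG : IsExpanderSequence G) :
    averagingProjection V ∈ uniformRoeAlgebra (Σ n, V n) := by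
  classical
  obtain ⟨⟨D', hD'⟩, -, c, hc, hexp⟩ := hG
  obtain ⟨D, hD0, hD⟩ : ∃ D : ℕ, 0 < D ∧ ∀ n v, ((G n).neighborSet v).ncard ≤ D :=
    ⟨D' + 1, D'.succ_pos, fun n v => (hD' n v).trans D'.le_succ⟩
  set P := averagingProjection V with hP
  let T := blockOperator (fun n => lazyWalk (𝕜 := ℂ) (G n) D)
    fun n f => sum_norm_sq_lazyWalk_le (hD n) hD0 f
  have hT : ∀ (f : L2 (Σ n, V n)) (n : ℕ) (x : V n),
      T f ⟨n, x⟩ = lazyWalk (G n) D (fun y => f ⟨n, y⟩) x := blockOperator_apply _ _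
  have hTP : T * P = P := by
    ext f ⟨n, x⟩
    simp only [mul_apply_eq_comp, hT, hP, averagingProjection_apply, lazyWalk_const]
  have hPT : P * T = P := by
    ext f ⟨n, x⟩
    simp only [mul_apply_eq_comp, hT, hP, averagingProjection_apply, sum_lazyWalk]
  have hPP : P * P = P := averagingProjection_mul_self
  have hpow : ∀ k : ℕ, T ^ k * P = P := fun k => by
    induction k with
    | zero => rw [pow_zero, one_mul]
    | succ k ih => rw [pow_succ, mul_assoc, hTP, ih]
  -- The shift avoids exponent `0`, where the identity would read `1 = 1 - P`.
  have hsub : ∀ k : ℕ, (T - P) ^ (k + 1) = T ^ (k + 1) - P := fun k => by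
    induction k with
    | zero => rw [zero_add, pow_one, pow_one]
    | succ k ih =>
      rw [pow_succ, ih, sub_mul, mul_sub, mul_sub, hpow, hPT, hPP, ← pow_succ]
      abel
  -- Truncated at `0` so that `√q` squares back to `q`.
  set q : ℝ := max (1 - c ^ 2 / (16 * D ^ 2)) 0 with hq
  have hq0 : 0 ≤ q := le_max_right _ _
  have hq1 : q < 1 := by
    have : (0 : ℝ) < D := by exact_mod_cast hD0
    exact max_lt (sub_lt_self _ (by positivity)) one_pos
  have hnorm : ‖T - P‖ ≤ √q := by
    refine ContinuousLinearMap.opNorm_le_bound _ (Real.sqrt_nonneg q) fun f => ?_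
    refine le_of_sq_le_sq ?_ (by positivity)
    rw [mul_pow, Real.sq_sqrt hq0]
    refine norm_sq_le_of_blocks fun n => ?_
    have h := (hexp n).sum_norm_sq_lazyWalk_sub_le (hD n) hD0 hc.le (le_max_left _ _) hq0
      fun y => f ⟨n, y⟩
    convert h using 4 with x
    rw [sub_apply, lp.coeFn_sub, Pi.sub_apply, hT, hP,
      averagingProjection_apply]
  have hlt : ‖T - P‖ < 1 := hnorm.trans_lt ((Real.sqrt_lt' one_pos).2 (by rwa [one_pow]))
  have hmem : T ∈ algebraicUniformRoeAlgebra (Σ n, V n) := by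
    refine ⟨1, ?_⟩
    rintro ⟨n, x⟩ ⟨m, y⟩ hne
    rw [coeff, hT, lazyWalk_apply] at hne
    by_contra hdist
    refine hne ?_
    by_cases hnm : n = m
    · subst hnm
      rw [hX.dist_same, not_le] at hdist
      have hxy : x ≠ y := by rintro rfl; simp at hdist; linarith
      have hadj : ¬ (G n).Adj x y := fun h => by
        rw [SimpleGraph.dist_eq_one_iff_adj.2 h] at hdist
        norm_num at hdist
      have h0 : ∀ z, (adj (G n) x z : ℂ) * (delta (⟨n, y⟩ : Σ n, V n) : L2 (Σ n, V n)) ⟨n, z⟩ = 0 :=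
        fun z => by
          by_cases hz : z = y
          · subst hz; simp [adj, hadj]
          · rw [delta_apply_ne fun h => hz (by simpa using h), mul_zero]
      rw [delta_apply_ne fun h => hxy (by simpa using h)]
      simp [h0]
    · have h0 : ∀ z, (delta (⟨m, y⟩ : Σ n, V n) : L2 (Σ n, V n)) ⟨n, z⟩ = 0 := fun z =>
        delta_apply_ne fun h => hnm (congrArg Sigma.fst h)
      simp [h0]
  have hlim : Tendsto (fun k : ℕ => T ^ (k + 1)) atTop (nhds P) := by
    have h := ((tendsto_pow_atTop_nhds_zero_of_norm_lt_one hlt).comp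
      (tendsto_add_atTop_nat 1)).add_const P
    rw [zero_add] at h
    refine h.congr fun k => ?_
    rw [Function.comp_apply, hsub, sub_add_cancel]
  exact mem_closure_of_tendsto hlim (Eventually.of_forall fun k => pow_mem hmem (k + 1))

end Equivalence

end CoarseGraph

open CoarseGraph in
theorem corollary7p4 :
    (∀ (V : ℕ → Type*) [∀ n, Fintype (V n)] (G : ∀ n, SimpleGraph (V n))
        [MetricSpace (Σ n, V n)],
      (∀ n, (G n).Connected) →
      UniformlyBoundedDegree G →
      Tendsto (fun n => Fintype.card (V n)) atTop atTop →
      (∀ n, HasManyMaximalCheegerSets (G n)) →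
      IsCoarseDisjointUnion G →
      (IsExpanderSequence G ↔ averagingProjection V ∈ uniformRoeAlgebra (Σ n, V n))) ∧
    (∀ (W : Type*) [Fintype W] (H : SimpleGraph W),
      H.Connected → IsVertexTransitive H → 2 ≤ Fintype.card W →
      HasManyMaximalCheegerSets H) := by
  refine ⟨fun V _ G _ hG hdeg hcard hmany hX => ⟨fun h => h.averagingProjection_mem hX,
    fun h => ⟨hdeg, hcard, exists_expander_of_averagingProjection_mem hG hdeg hmany hX h⟩⟩,
    fun W _ H _ htrans hcard => htrans.hasManyMaximalCheegerSets hcard⟩
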